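/- Let $p(m)$ be the number of partitions of the integer $m$, with $p(0)=1$ and $p(m)=0$ for $m<0$. The crank of a partition is its largest part if it has no part equal to $1$ (and $0$ for the empty partition); otherwise it is the number of parts larger than $\omega$ minus $\omega$, where $\omega$ is the number of parts equal to $1$. For $n\ge 0$, $n\neq 1$, let $D(n)$ be the number of partitions of $n$ with positive crank, and put $D(1)=1$; this is the usual convention for crank counts, in which $M(m,1)$ is the coefficient of $z^m q$ in $\prod_{i\ge1}\frac{1-q^i}{(1-zq^i)(1-z^{-1}q^i)}$ and $D(1)=\sum_{m\ge1}M(m,1)$. Then for all integers $n\ge 0$ and $k\ge 1$, $$(-1)^{k-1}\left(\sum_{j=1}^{k}(-1)^{j-1}p\Big(n-\frac{j(j+1)}{2}\Big)-D(n)\right)\ge 0,$$ with strict inequality if $n\ge \frac{(k+1)(k+2)}{2}$. For example, for all $n\ge 0$: $p(n-1)\ge D(n)$; $p(n-1)-p(n-3)\le D(n)$; $p(n-1)-p(n-3)+p(n-6)\ge D(n)$; and $p(n-1)-p(n-3)+p(n-6)-p(n-10)\le D(n)$. -/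

import Mathlib

/-- The partition function `p` on the integers: `p m` is the number of partitions of `m` if
`0 ≤ m` (so `p 0 = 1`, for the empty partition), and `p m = 0` if `m < 0`. -/
def partitionFn (m : ℤ) : ℤ :=
  if 0 ≤ m then (Fintype.card (Nat.Partition m.toNat) : ℤ) else 0

/-- The Andrews–Garvan crank of a partition: the largest part if no part is equal to `1`
(this gives `0` for the empty partition), and otherwise the number of parts that are larger than
the number of ones, minus the number of ones. -/
def crank {n : ℕ} (P : Nat.Partition n) : ℤ :=
  if P.parts.count 1 = 0 then (P.parts.sup : ℤ)
  else ((P.parts.filter (fun i => P.parts.count 1 < i)).card : ℤ) - (P.parts.count 1 : ℤ)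

/-- `positiveCrankCount n` is the number `D(n)` of partitions of `n` with positive crank.
For `n = 1` the standard convention for crank counts applies: there `M(m, 1)` is the coefficient of
`z ^ m * q` in `(q;q)_∞ / ((zq;q)_∞ (q/z;q)_∞)`, that is `M(-1, 1) = M(1, 1) = 1`,
`M(0, 1) = -1` and `M(m, 1) = 0` otherwise, so that `D(1) = M(1, 1) = 1`. -/
def positiveCrankCount (n : ℕ) : ℤ :=
  if n = 1 then 1
  else ((Finset.univ.filter (fun P : Nat.Partition n => 0 < crank P)).card : ℤ)

/-- The partial sum `∑_{j=1}^k (-1)^(j-1) p(n - j(j+1)/2)`. -/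
def truncatedSum (n k : ℕ) : ℤ :=
  ∑ j ∈ Finset.Icc 1 k, (-1 : ℤ) ^ (j - 1) * partitionFn ((n : ℤ) - ((j * (j + 1) / 2 : ℕ) : ℤ))

/-! Write P for the generating function of all partitions and R(d,s) for `rectSeries d s`. Durfee
rectangles suggest R(d,0) = P (`rectSeries_zero_right`); with a contiguous relation this gives
R(d,1) = P - q^(d+1) R(d+1,1). Iterating from d = 0 expands P - R(0,1) as the truncated sum plus
(-1)^k q^((k+1)(k+2)/2) R(k+1,1). That remainder has nonnegative coefficients, positive from its
leading exponent on.

It remains to see that P - R(0,1) generates D(n) (`positiveCrankCount_eq_coeff`). A nonempty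
partition has positive crank iff it has no ones, or has w ≥ 1 ones and w + d parts above w with d ≥
1. The second kind has generating function (1-q) q^d times the w-th term of R(d,2), and (1-q) q^d
R(d,2) = R(d,1) - R(d-1,1) telescopes in d. -/

open PowerSeries

/-! ### Generating functions of restricted partitions -/

/-- The number of partitions of `n` whose multiset of parts satisfies `pr`. -/
noncomputable def partCount (pr : Multiset ℕ → Prop) (n : ℕ) : ℤ := by
  classical exact ((Finset.univ.filter (fun P : Nat.Partition n => pr P.parts)).card : ℤ)

/-- The generating function of the partitions whose multiset of parts satisfies `pr`. -/
noncomputable def partGF (pr : Multiset ℕ → Prop) : ℤ⟦X⟧ := PowerSeries.mk (partCount pr)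

theorem partCount_nonneg (pr : Multiset ℕ → Prop) (n : ℕ) : 0 ≤ partCount pr n := by
  unfold partCount; positivity

theorem partCount_pos {pr : Multiset ℕ → Prop} {n : ℕ} (P : Nat.Partition n) (h : pr P.parts) :
    0 < partCount pr n := by
  classical
  unfold partCount
  exact_mod_cast Finset.card_pos.mpr ⟨P, by simpa using h⟩

theorem partCount_congr {pr qr : Multiset ℕ → Prop} {n : ℕ}
    (h : ∀ P : Nat.Partition n, pr P.parts ↔ qr P.parts) : partCount pr n = partCount qr n := by
  classical
  unfold partCount
  simp only [h]

theorem partGF_congr {pr qr : Multiset ℕ → Prop}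
    (h : ∀ s : Multiset ℕ, 0 ∉ s → (pr s ↔ qr s)) : partGF pr = partGF qr := by
  ext n
  simp only [partGF, coeff_mk]
  exact partCount_congr fun P => h _ fun h0 => (P.parts_pos h0).ne' rfl

theorem partCount_eq_partCount_of_bij {pr qr : Multiset ℕ → Prop} {n m : ℕ}
    (f g : Multiset ℕ → Multiset ℕ)
    (hf : ∀ s, 0 ∉ s → s.sum = n → pr s →
      0 ∉ f s ∧ (f s).sum = m ∧ qr (f s) ∧ g (f s) = s)
    (hg : ∀ s, 0 ∉ s → s.sum = m → qr s →
      0 ∉ g s ∧ (g s).sum = n ∧ pr (g s) ∧ f (g s) = s) :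
    partCount pr n = partCount qr m := by
  classical
  have h0 : ∀ {k : ℕ} (P : Nat.Partition k), 0 ∉ P.parts :=
    fun P h => (P.parts_pos h).ne' rfl
  unfold partCount
  congr 1
  refine Finset.card_bij'
    (fun P hP => ⟨f P.parts, ?_, ?_⟩) (fun P hP => ⟨g P.parts, ?_, ?_⟩) ?_ ?_ ?_ ?_
  · intro i hi
    have := hf P.parts (h0 P) P.parts_sum (by simpa using hP)
    exact Nat.pos_of_ne_zero fun e => this.1 (e ▸ hi)
  · exact (hf P.parts (h0 P) P.parts_sum (by simpa using hP)).2.1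
  · intro i hi
    have := hg P.parts (h0 P) P.parts_sum (by simpa using hP)
    exact Nat.pos_of_ne_zero fun e => this.1 (e ▸ hi)
  · exact (hg P.parts (h0 P) P.parts_sum (by simpa using hP)).2.1
  · intro P hP
    simpa using (hf P.parts (h0 P) P.parts_sum (by simpa using hP)).2.2.1
  · intro P hP
    simpa using (hg P.parts (h0 P) P.parts_sum (by simpa using hP)).2.2.1
  · intro P hP
    ext1
    exact (hf P.parts (h0 P) P.parts_sum (by simpa using hP)).2.2.2
  · intro P hP
    ext1
    exact (hg P.parts (h0 P) P.parts_sum (by simpa using hP)).2.2.2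

theorem partCount_eq_zero {pr : Multiset ℕ → Prop} {n : ℕ}
    (h : ∀ s : Multiset ℕ, 0 ∉ s → s.sum = n → ¬ pr s) : partCount pr n = 0 := by
  classical
  unfold partCount
  have : (Finset.univ.filter (fun P : Nat.Partition n => pr P.parts)) = ∅ := by
    ext P
    simpa using h P.parts (fun h0 => (P.parts_pos h0).ne' rfl) P.parts_sum
  rw [this]; simp

/-- A bijection that raises the sum by `k` multiplies the generating function by `X ^ k`. -/
theorem partGF_eq_X_pow_mul {pr qr : Multiset ℕ → Prop} (k : ℕ)
    (f g : Multiset ℕ → Multiset ℕ)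
    (hf : ∀ s, 0 ∉ s → pr s →
      0 ∉ f s ∧ (f s).sum + k = s.sum ∧ qr (f s) ∧ g (f s) = s)
    (hg : ∀ s, 0 ∉ s → qr s →
      0 ∉ g s ∧ (g s).sum = s.sum + k ∧ pr (g s) ∧ f (g s) = s) :
    partGF pr = X ^ k * partGF qr := by
  ext n
  rw [coeff_X_pow_mul']
  simp only [partGF, coeff_mk]
  split_ifs with hk
  · refine partCount_eq_partCount_of_bij f g ?_ ?_
    · intro s h0 hs hp
      obtain ⟨h1, h2, h3, h4⟩ := hf s h0 hp
      exact ⟨h1, by omega, h3, h4⟩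
    · intro s h0 hs hp
      obtain ⟨h1, h2, h3, h4⟩ := hg s h0 hp
      exact ⟨h1, by omega, h3, h4⟩
  · refine partCount_eq_zero fun s h0 hs hp => ?_
    have := (hf s h0 hp).2.1
    omega

theorem partGF_mem {pr : Multiset ℕ → Prop} {a : ℕ} (ha : 1 ≤ a) :
    partGF (fun s => a ∈ s ∧ pr s) = X ^ a * partGF (fun s => pr (a ::ₘ s)) := by
  refine partGF_eq_X_pow_mul a (fun s => s.erase a) (fun s => a ::ₘ s) ?_ ?_
  · rintro s h0 ⟨h1, h2⟩
    refine ⟨fun h => h0 (Multiset.mem_of_mem_erase h), ?_, ?_, Multiset.cons_erase h1⟩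
    · rw [add_comm, Multiset.sum_erase h1]
    · simpa only [Multiset.cons_erase h1] using h2
  · intro s h0 h1
    refine ⟨?_, by simp [add_comm], ⟨by simp, h1⟩, by simp⟩
    simp only [Multiset.mem_cons, not_or]
    exact ⟨by omega, h0⟩

theorem partGF_split (pr qr : Multiset ℕ → Prop) :
    partGF pr = partGF (fun s => qr s ∧ pr s) + partGF (fun s => ¬ qr s ∧ pr s) := by
  classical
  ext n
  simp only [partGF, coeff_mk, map_add, partCount]
  rw [← Finset.card_filter_add_card_filter_not (s := Finset.univ.filter
    (fun P : Nat.Partition n => pr P.parts)) (fun P => qr P.parts)]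
  simp only [Finset.filter_filter, Nat.cast_add]
  congr! 4 <;> exact and_comm

/-- Splitting by whether `a` is a part. -/
theorem partGF_split_mem (pr : Multiset ℕ → Prop) {a : ℕ} (ha : 1 ≤ a) :
    partGF pr = X ^ a * partGF (fun s => pr (a ::ₘ s)) + partGF (fun s => a ∉ s ∧ pr s) := by
  rw [partGF_split pr (fun s => a ∈ s), partGF_mem ha]

theorem partGF_eq_zero_parts : partGF (fun s => s = 0) = 1 := by
  ext n
  simp only [partGF, coeff_mk, coeff_one]
  split_ifs with h
  · subst h
    classical
    simp [partCount]
  · exact partCount_eq_zero fun s _ hs h0 => h (by simp [← hs, h0])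

/-! ### Bounded parts, and partitions with prescribed ones and large parts -/

/-- The generating function of the partitions with all parts at most `a`. -/
noncomputable def boundedGF (a : ℕ) : ℤ⟦X⟧ := partGF (fun s => ∀ x ∈ s, x ≤ a)

theorem boundedGF_zero : boundedGF 0 = 1 := by
  rw [← partGF_eq_zero_parts]
  refine partGF_congr fun s h0 => ⟨fun h => ?_, fun h => by simp [h]⟩
  refine Multiset.eq_zero_of_forall_notMem fun x hx => h0 ?_
  have := h x hx
  obtain rfl : x = 0 := by omega
  exact hx

/-- The recursion of 1/(q;q)_a, obtained by splitting on whether a + 1 is a part. -/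
theorem boundedGF_succ (a : ℕ) :
    boundedGF (a + 1) = X ^ (a + 1) * boundedGF (a + 1) + boundedGF a := by
  conv_lhs => rw [boundedGF, partGF_split_mem _ (Nat.le_add_left 1 a)]
  refine congrArg₂ (· + ·) (congrArg _ (partGF_congr fun s _ => by simp)) ?_
  · refine partGF_congr fun s _ => ⟨fun h x hx => ?_, fun h => ⟨fun hx => ?_, fun x hx => ?_⟩⟩
    · have := h.2 x hx
      have : x ≠ a + 1 := fun e => h.1 (e ▸ hx)
      omega
    · have := h _ hx; omega
    · have := h _ hx; omega

/-- The generating function of all partitions. -/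
noncomputable def allGF : ℤ⟦X⟧ := partGF (fun _ => True)

theorem coeff_allGF (n : ℕ) : coeff n allGF = partitionFn n := by
  classical
  simp [allGF, partGF, partCount, partitionFn]

theorem coeff_allGF_eq_coeff_boundedGF {n a : ℕ} (h : n ≤ a) :
    coeff n allGF = coeff n (boundedGF a) := by
  simp only [allGF, boundedGF, partGF, coeff_mk]
  exact partCount_congr fun P => by
    simp only [true_iff]
    exact fun x hx => (P.le_of_mem_parts hx).trans h

theorem coeff_boundedGF_nonneg (a n : ℕ) : 0 ≤ coeff n (boundedGF a) := by
  simp only [boundedGF, partGF, coeff_mk]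
  exact partCount_nonneg _ _

theorem coeff_boundedGF_pos {a : ℕ} (ha : 1 ≤ a) (n : ℕ) : 0 < coeff n (boundedGF a) := by
  simp only [boundedGF, partGF, coeff_mk]
  refine partCount_pos ⟨Multiset.replicate n 1, ?_, by simp⟩ ?_
  · intro i hi; simp [Multiset.eq_of_mem_replicate hi]
  · intro i hi
    have := Multiset.eq_of_mem_replicate hi
    omega

theorem partGF_one_notMem : partGF (fun s => s.count 1 = 0) = (1 - X) * allGF := by
  have h := partGF_split_mem (fun _ => True) le_rfl
  have e : partGF (fun s => s.count 1 = 0) = partGF (fun s => 1 ∉ s ∧ True) :=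
    partGF_congr fun s _ => by simp
  rw [e, allGF]
  linear_combination -h

/-- Partitions into exactly `m` parts, each larger than `w`. -/
theorem partGF_card_eq (w m : ℕ) :
    partGF (fun s => (∀ x ∈ s, w < x) ∧ s.card = m) = X ^ (m * (w + 1)) * boundedGF m := by
  induction m generalizing w with
  | zero =>
    rw [boundedGF_zero, zero_mul, pow_zero, mul_one, ← partGF_eq_zero_parts]
    exact partGF_congr fun s _ => ⟨fun h => Multiset.card_eq_zero.mp h.2, fun h => by simp [h]⟩
  | succ m ih =>
    have h1 := partGF_split_mem (fun s => (∀ x ∈ s, w < x) ∧ s.card = m + 1)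
      (Nat.le_add_left 1 w)
    have h2 : partGF (fun s => (∀ x ∈ (w + 1) ::ₘ s, w < x) ∧ ((w + 1) ::ₘ s).card = m + 1) =
        partGF (fun s => (∀ x ∈ s, w < x) ∧ s.card = m) :=
      partGF_congr fun s _ => by simp
    -- When w + 1 is absent, lowering each of the m + 1 parts by one keeps them all above w.
    have h3 : partGF (fun s => w + 1 ∉ s ∧ (∀ x ∈ s, w < x) ∧ s.card = m + 1) =
        X ^ (m + 1) * partGF (fun s => (∀ x ∈ s, w < x) ∧ s.card = m + 1) := by
      refine partGF_eq_X_pow_mul (m + 1) (fun s => s.map (· - 1)) (fun s => s.map (· + 1)) ?_ ?_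
      · rintro s h0 ⟨ha, hb, hc⟩
        have hid : (s.map (· - 1)).map (· + 1) = s := by
          rw [Multiset.map_map]
          conv_rhs => rw [← Multiset.map_id s]
          refine Multiset.map_congr rfl fun x hx => ?_
          have := hb x hx
          simp only [Function.comp, id]; omega
        have hbig : ∀ x ∈ s.map (· - 1), w < x := by
          intro x hx
          obtain ⟨y, hy, rfl⟩ := Multiset.mem_map.mp hx
          have := hb y hy
          have : y ≠ w + 1 := fun e => ha (e ▸ hy)
          show w < y - 1
          omega
        refine ⟨fun h => absurd (hbig 0 h) (by omega), ?_, ⟨hbig, by simpa using hc⟩, hid⟩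
        conv_rhs => rw [← hid]
        rw [Multiset.sum_map_add]
        simp [hc, add_comm]
      · rintro s h0 ⟨hb, hc⟩
        refine ⟨by simp, by simp [Multiset.sum_map_add, hc, add_comm], ⟨?_, ?_, by simpa using hc⟩, ?_⟩
        · intro h
          obtain ⟨y, hy, he⟩ := Multiset.mem_map.mp h
          have := hb y hy
          omega
        · intro x hx
          obtain ⟨y, hy, rfl⟩ := Multiset.mem_map.mp hx
          have := hb y hy
          show w < y + 1
          omega
        · simp [Multiset.map_map]
    rw [h2, h3, ih] at h1
    have h4 := boundedGF_succ m
    have hne : (1 - X ^ (m + 1) : ℤ⟦X⟧) ≠ 0 := by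
      intro h
      have := congrArg (coeff 0) h
      simp at this
    refine mul_left_cancel₀ hne ?_
    have e : (X : ℤ⟦X⟧) ^ ((m + 1) * (w + 1)) = X ^ (w + 1) * X ^ (m * (w + 1)) := by
      rw [← pow_add]; congr 1; ring
    rw [e]
    linear_combination h1 - X ^ (w + 1) * X ^ (m * (w + 1)) * h4

/-- Partitions with no ones, arbitrary parts in `[2, j]` and exactly `m` parts above `w ≥ j`. -/
theorem partGF_two_scale {w j : ℕ} (m : ℕ) (hj : 1 ≤ j) (hw : j ≤ w) :
    partGF (fun s => (∀ x ∈ s, (2 ≤ x ∧ x ≤ j) ∨ w < x) ∧ (s.filter (w < ·)).card = m) =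
      (1 - X) * X ^ (m * (w + 1)) * boundedGF j * boundedGF m := by
  induction j, hj using Nat.le_induction with
  | base =>
    -- For j = 1 the range [2, j] is empty, and the factor 1 - q cancels 1/(q;q)_1.
    have h1 := boundedGF_succ 0
    rw [boundedGF_zero] at h1
    have : partGF (fun s => (∀ x ∈ s, (2 ≤ x ∧ x ≤ 1) ∨ w < x) ∧ (s.filter (w < ·)).card = m) =
        partGF (fun s => (∀ x ∈ s, w < x) ∧ s.card = m) := by
      refine partGF_congr fun s _ => ?_
      have e : (∀ x ∈ s, (2 ≤ x ∧ x ≤ 1) ∨ w < x) ↔ ∀ x ∈ s, w < x :=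
        forall₂_congr fun x _ => by omega
      rw [e]
      exact and_congr_right fun h => by rw [Multiset.filter_eq_self.mpr h]
    rw [this, partGF_card_eq]
    simp only [zero_add, pow_one] at h1
    linear_combination -X ^ (m * (w + 1)) * boundedGF m * h1
  | succ j hj ih =>
    have ih := ih (by omega)
    have h1 := partGF_split_mem (fun s =>
      (∀ x ∈ s, (2 ≤ x ∧ x ≤ j + 1) ∨ w < x) ∧ (s.filter (w < ·)).card = m)
      (Nat.le_add_left 1 j)
    have h2 : partGF (fun s => (∀ x ∈ (j + 1) ::ₘ s, (2 ≤ x ∧ x ≤ j + 1) ∨ w < x) ∧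
        (((j + 1) ::ₘ s).filter (w < ·)).card = m) =
        partGF (fun s => (∀ x ∈ s, (2 ≤ x ∧ x ≤ j + 1) ∨ w < x) ∧
          (s.filter (w < ·)).card = m) := by
      refine partGF_congr fun s _ => ?_
      rw [Multiset.filter_cons_of_neg _ (by omega)]
      simp only [Multiset.mem_cons, forall_eq_or_imp]
      have : (2 ≤ j + 1 ∧ j + 1 ≤ j + 1) ∨ w < j + 1 := by omega
      tauto
    have h3 : partGF (fun s => j + 1 ∉ s ∧ (∀ x ∈ s, (2 ≤ x ∧ x ≤ j + 1) ∨ w < x) ∧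
        (s.filter (w < ·)).card = m) =
        partGF (fun s => (∀ x ∈ s, (2 ≤ x ∧ x ≤ j) ∨ w < x) ∧
          (s.filter (w < ·)).card = m) := by
      refine partGF_congr fun s _ => ?_
      rw [← and_assoc]
      refine and_congr_left fun _ => ⟨fun h x hx => ?_, fun h => ⟨fun hx => ?_, fun x hx => ?_⟩⟩
      · have := h.2 x hx
        have : x ≠ j + 1 := fun e => h.1 (e ▸ hx)
        omega
      · have := h _ hx; omega
      · have := h _ hx; omega
    rw [h2, h3, ih] at h1
    have h4 := boundedGF_succ j
    have hne : (1 - X ^ (j + 1) : ℤ⟦X⟧) ≠ 0 := by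
      intro h
      have := congrArg (coeff 0) h
      simp at this
    refine mul_left_cancel₀ hne ?_
    linear_combination h1 - (1 - X) * X ^ (m * (w + 1)) * boundedGF m * h4

/-- Each 1 costs a factor q and is not counted among the parts above w, since w ≥ 1. Without ones
this is `partGF_two_scale` at j = w. -/
theorem partGF_ones (c : ℕ) {w : ℕ} (m : ℕ) (hw : 1 ≤ w) :
    partGF (fun s => s.count 1 = c ∧ (s.filter (w < ·)).card = m) =
      (1 - X) * X ^ (c + m * (w + 1)) * boundedGF w * boundedGF m := by
  induction c with
  | zero =>
    rw [zero_add, ← partGF_two_scale m hw le_rfl]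
    refine partGF_congr fun s h0 => and_congr_left fun _ => ?_
    rw [Multiset.count_eq_zero]
    refine ⟨fun h x hx => ?_, fun h hx => ?_⟩
    · have : x ≠ 0 := fun e => h0 (e ▸ hx)
      have : x ≠ 1 := fun e => h (e ▸ hx)
      omega
    · have := h _ hx; omega
  | succ c ih =>
    have h1 := partGF_split_mem (fun s => s.count 1 = c + 1 ∧ (s.filter (w < ·)).card = m) le_rfl
    have h2 : partGF (fun s => 1 ∉ s ∧ s.count 1 = c + 1 ∧ (s.filter (w < ·)).card = m) = 0 := by
      ext n
      simp only [partGF, coeff_mk, map_zero]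
      refine partCount_eq_zero fun s _ _ h => ?_
      have := Multiset.count_eq_zero.mpr h.1
      omega
    have h3 : partGF (fun s => (1 ::ₘ s).count 1 = c + 1 ∧
        ((1 ::ₘ s).filter (w < ·)).card = m) =
        partGF (fun s => s.count 1 = c ∧ (s.filter (w < ·)).card = m) :=
      partGF_congr fun s _ => by
        rw [Multiset.filter_cons_of_neg _ (by omega), Multiset.count_cons_self]
        simp
    rw [h2, h3, ih] at h1
    rw [h1, add_right_comm c 1, pow_succ X (c + m * (w + 1))]
    ring

/-! ### Durfee rectangle series and their contiguous relations -/

theorem eq_of_forall_X_pow_dvd {f g : ℤ⟦X⟧} (h : ∀ N : ℕ, (X : ℤ⟦X⟧) ^ N ∣ f - g) : f = g := by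
  ext n
  have := X_pow_dvd_iff.mp (h (n + 1)) n (Nat.lt_succ_self n)
  rwa [map_sub, sub_eq_zero] at this

/-- The `N`-th partial sum of `rectSeries d s`. -/
noncomputable def rectSum (N d s : ℕ) : ℤ⟦X⟧ :=
  ∑ w ∈ Finset.range N, X ^ (w * (w + d) + s * w) * (boundedGF w * boundedGF (w + d))

/-- The series `∑ w, q ^ (w (w + d) + s w) / ((q; q)_w (q; q)_{w + d})`. -/
noncomputable def rectSeries (d s : ℕ) : ℤ⟦X⟧ :=
  PowerSeries.mk fun n => coeff n (rectSum (n + 1) d s)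

theorem coeff_rectSum_eq_of_lt {n N : ℕ} (d s : ℕ) (h : n < N) :
    coeff n (rectSum N d s) = coeff n (rectSeries d s) := by
  rw [rectSeries, coeff_mk]
  induction N, h using Nat.le_induction with
  | base => rfl
  | succ N hN ih =>
    rw [← ih, rectSum, Finset.sum_range_succ, map_add, ← rectSum, coeff_X_pow_mul', if_neg,
      add_zero]
    -- The N-th term has order at least N, so it cannot reach the coefficient of q^n.
    have : N ≤ N * (N + d) := Nat.le_mul_of_pos_right _ (by omega)
    omega

theorem X_pow_dvd_rectSeries_sub (N d s : ℕ) :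
    (X : ℤ⟦X⟧) ^ N ∣ rectSeries d s - rectSum N d s := by
  refine X_pow_dvd_iff.mpr fun n hn => ?_
  rw [map_sub, coeff_rectSum_eq_of_lt d s hn, sub_self]

theorem X_pow_dvd_rectSum_succ_sub (N d s : ℕ) :
    (X : ℤ⟦X⟧) ^ N ∣ rectSum (N + 1) d s - rectSum N d s := by
  refine X_pow_dvd_iff.mpr fun n hn => ?_
  rw [map_sub, coeff_rectSum_eq_of_lt d s hn, coeff_rectSum_eq_of_lt d s (by omega), sub_self]

/-- The difference puts 1 - q^w on the w-th term: it kills w = 0 and turns 1/(q;q)_w into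
1/(q;q)_(w-1); then shift w. -/
theorem rectSum_sub_rectSum (N d s : ℕ) :
    rectSum (N + 1) d s - rectSum (N + 1) d (s + 1) =
      X ^ (1 + d + s) * rectSum N (d + 1) (s + 1) := by
  simp only [rectSum]
  rw [← Finset.sum_sub_distrib, Finset.sum_range_succ', Finset.mul_sum]
  simp only [Nat.zero_mul, Nat.mul_zero, sub_self, add_zero]
  refine Finset.sum_congr rfl fun w _ => ?_
  have h := boundedGF_succ w
  have e1 : (w + 1) * (w + 1 + d) + (s + 1) * (w + 1) =
    ((w + 1) * (w + 1 + d) + s * (w + 1)) + (w + 1) := by ring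
  have e2 : (w + 1) * (w + 1 + d) + s * (w + 1) =
    (1 + d + s) + (w * (w + (d + 1)) + (s + 1) * w) := by ring
  rw [e1, pow_add, e2, pow_add, show w + (d + 1) = w + 1 + d by ring]
  linear_combination X ^ (1 + d + s) * X ^ (w * (w + 1 + d) + (s + 1) * w) *
    boundedGF (w + 1 + d) * h

/-- Termwise, the factor 1 - q^(w+d+1) turns 1/(q;q)_(w+d+1) into 1/(q;q)_(w+d). -/
theorem rectSum_succ_sub (N d s : ℕ) :
    rectSum N (d + 1) s - X ^ (d + 1) * rectSum N (d + 1) (s + 1) = rectSum N d (s + 1) := by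
  simp only [rectSum]
  rw [Finset.mul_sum, ← Finset.sum_sub_distrib]
  refine Finset.sum_congr rfl fun w _ => ?_
  have h := boundedGF_succ (w + d)
  have e1 : w * (w + (d + 1)) + (s + 1) * w = (w * (w + d) + (s + 1) * w) + w := by ring
  have e2 : w * (w + (d + 1)) + s * w = w * (w + d) + (s + 1) * w := by ring
  rw [add_assoc, pow_add] at h
  rw [e1, e2, pow_add X (w * (w + d) + (s + 1) * w) w]
  linear_combination X ^ (w * (w + d) + (s + 1) * w) * boundedGF w * h

theorem rectSeries_sub_rectSeries (d s : ℕ) :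
    rectSeries d s - rectSeries d (s + 1) = X ^ (1 + d + s) * rectSeries (d + 1) (s + 1) := by
  refine eq_of_forall_X_pow_dvd fun N => ?_
  have h := rectSum_sub_rectSum N d s
  obtain ⟨a, ha⟩ := X_pow_dvd_rectSeries_sub N d s
  obtain ⟨b, hb⟩ := X_pow_dvd_rectSeries_sub N d (s + 1)
  obtain ⟨c, hc⟩ := X_pow_dvd_rectSeries_sub N (d + 1) (s + 1)
  obtain ⟨a', ha'⟩ := X_pow_dvd_rectSum_succ_sub N d s
  obtain ⟨b', hb'⟩ := X_pow_dvd_rectSum_succ_sub N d (s + 1)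
  exact ⟨a - b - a' + b' - X ^ (1 + d + s) * c, by
    linear_combination ha - hb - ha' + hb' + h - X ^ (1 + d + s) * hc⟩

theorem rectSeries_succ_sub (d s : ℕ) :
    rectSeries (d + 1) s - X ^ (d + 1) * rectSeries (d + 1) (s + 1) = rectSeries d (s + 1) := by
  refine eq_of_forall_X_pow_dvd fun N => ?_
  have h := rectSum_succ_sub N d s
  obtain ⟨a, ha⟩ := X_pow_dvd_rectSeries_sub N (d + 1) s
  obtain ⟨b, hb⟩ := X_pow_dvd_rectSeries_sub N (d + 1) (s + 1)
  obtain ⟨c, hc⟩ := X_pow_dvd_rectSeries_sub N d (s + 1)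
  exact ⟨a - X ^ (d + 1) * b - c, by
    linear_combination ha - X ^ (d + 1) * hb - hc + h⟩

/-- The term w = 0 is 1/(q;q)_d, which agrees with P through q^d; every later term has order above
d. -/
theorem X_pow_dvd_rectSeries_sub_allGF (d s : ℕ) :
    (X : ℤ⟦X⟧) ^ (d + 1) ∣ rectSeries d s - allGF := by
  refine X_pow_dvd_iff.mpr fun n hn => ?_
  rw [map_sub, coeff_allGF_eq_coeff_boundedGF (Nat.lt_succ_iff.mp hn), rectSeries, coeff_mk,
    rectSum, Finset.sum_range_succ', map_add, map_sum, Finset.sum_eq_zero]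
  · simp [boundedGF_zero]
  · intro w _
    rw [coeff_X_pow_mul', if_neg]
    have : (w + 1) * (w + 1 + d) = w + 1 + d + w * (w + 1 + d) := by ring
    omega

/-- The two contiguous relations at s = 0 make the series independent of d, and it tends to P as d
grows. -/
theorem rectSeries_zero_right (d : ℕ) : rectSeries d 0 = allGF := by
  have hstep : ∀ e, rectSeries (e + 1) 0 = rectSeries e 0 := fun e => by
    have h1 := rectSeries_sub_rectSeries e 0
    have h2 := rectSeries_succ_sub e 0
    rw [add_zero, add_comm 1 e] at h1
    linear_combination h2 - h1
  have hconst : ∀ N, rectSeries (d + N) 0 = rectSeries d 0 := fun N => by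
    induction N with
    | zero => rfl
    | succ N ih => rw [← add_assoc, hstep, ih]
  refine eq_of_forall_X_pow_dvd fun N => ?_
  rw [← hconst N]
  exact (pow_dvd_pow _ (by omega)).trans (X_pow_dvd_rectSeries_sub_allGF (d + N) 0)

theorem rectSeries_one_right (d : ℕ) :
    rectSeries d 1 = allGF - X ^ (d + 1) * rectSeries (d + 1) 1 := by
  have h := rectSeries_sub_rectSeries d 0
  rw [rectSeries_zero_right, add_zero, zero_add, add_comm 1 d] at h
  linear_combination -h

theorem rectSeries_two_right (d : ℕ) :
    (1 - X) * X ^ (d + 1) * rectSeries (d + 1) 2 = rectSeries (d + 1) 1 - rectSeries d 1 := by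
  have h1 := rectSeries_sub_rectSeries d 1
  have h2 := rectSeries_succ_sub d 1
  rw [show 1 + d + 1 = d + 1 + 1 by ring, pow_succ] at h1
  linear_combination h1 - h2

theorem coeff_rectSeries_nonneg (d s n : ℕ) : 0 ≤ coeff n (rectSeries d s) := by
  rw [rectSeries, coeff_mk, rectSum, map_sum]
  refine Finset.sum_nonneg fun w _ => ?_
  rw [coeff_X_pow_mul']
  split_ifs
  · rw [coeff_mul]
    exact Finset.sum_nonneg fun i _ =>
      mul_nonneg (coeff_boundedGF_nonneg _ _) (coeff_boundedGF_nonneg _ _)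
  · rfl

/-- The term w = 0 suffices: all coefficients of 1/(q;q)_d are positive once parts equal to 1 are
allowed. -/
theorem coeff_rectSeries_pos {d : ℕ} (hd : 1 ≤ d) (s n : ℕ) : 0 < coeff n (rectSeries d s) := by
  rw [rectSeries, coeff_mk, rectSum, Finset.sum_range_succ', map_add, map_sum]
  refine add_pos_of_nonneg_of_pos (Finset.sum_nonneg fun w _ => ?_) ?_
  · rw [coeff_X_pow_mul']
    split_ifs
    · rw [coeff_mul]
      exact Finset.sum_nonneg fun i _ =>
        mul_nonneg (coeff_boundedGF_nonneg _ _) (coeff_boundedGF_nonneg _ _)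
    · rfl
  · simpa [boundedGF_zero] using coeff_boundedGF_pos hd n

/-! ### Truncated expansion with remainder -/

/-- The finite form of the expansion of `rectSeries 0 1`. -/
theorem allGF_sub_rectSeries_zero_one (k : ℕ) :
    allGF - rectSeries 0 1 =
      ∑ j ∈ Finset.Icc 1 k, (-1) ^ (j - 1) * (X ^ (j * (j + 1) / 2) * allGF) +
        (-1) ^ k * (X ^ ((k + 1) * (k + 2) / 2) * rectSeries (k + 1) 1) := by
  induction k with
  | zero =>
    rw [rectSeries_one_right 0]
    simp
  | succ k ih =>
    rw [ih, Finset.sum_Icc_succ_top (by omega), rectSeries_one_right (k + 1)]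
    have e : (k + 1 + 1) * (k + 1 + 2) / 2 = (k + 1) * (k + 1 + 1) / 2 + (k + 1 + 1) := by
      rw [show (k + 1 + 1) * (k + 1 + 2) = (k + 1) * (k + 1 + 1) + (k + 1 + 1) * 2 by ring,
        Nat.add_mul_div_right _ _ (by norm_num)]
    rw [e, pow_add X, Nat.add_sub_cancel, pow_succ (-1 : ℤ⟦X⟧) k]
    ring

theorem coeff_X_pow_mul_allGF (n a : ℕ) :
    coeff n (X ^ a * allGF) = partitionFn ((n : ℤ) - (a : ℤ)) := by
  rw [coeff_X_pow_mul']
  split_ifs with h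
  · rw [coeff_allGF, Nat.cast_sub h]
  · rw [partitionFn, if_neg (by omega)]

theorem coeff_neg_one_pow_mul (n k : ℕ) (f : ℤ⟦X⟧) :
    coeff n ((-1) ^ k * f) = (-1) ^ k * coeff n f := by
  rcases Nat.even_or_odd k with hk | hk <;> simp [hk.neg_one_pow]

theorem coeff_allGF_sub_rectSeries (n k : ℕ) :
    coeff n (allGF - rectSeries 0 1) = truncatedSum n k +
      (-1) ^ k * coeff n (X ^ ((k + 1) * (k + 2) / 2) * rectSeries (k + 1) 1) := by
  rw [allGF_sub_rectSeries_zero_one k, map_add, map_sum, truncatedSum, coeff_neg_one_pow_mul]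
  congr 1
  refine Finset.sum_congr rfl fun j _ => ?_
  rw [coeff_neg_one_pow_mul, coeff_X_pow_mul_allGF]

/-! ### Positive crank and the telescoping sum -/

theorem sum_partGF_ones (n : ℕ) :
    coeff n (∑ w ∈ Finset.range n, ∑ d ∈ Finset.range n,
      partGF (fun s => s.count 1 = w + 1 ∧
        (s.filter (w + 1 < ·)).card = w + 1 + (d + 1))) =
      coeff n (X * allGF - rectSeries 0 1 + (1 - X)) := by
  have h1 : ∀ d : ℕ, coeff n ((1 - X) * X ^ (d + 1) * rectSeries (d + 1) 2) =
      coeff n ((1 - X) * (boundedGF (d + 1) - boundedGF d)) +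
      coeff n (∑ w ∈ Finset.range n, partGF (fun s => s.count 1 = w + 1 ∧
        (s.filter (w + 1 < ·)).card = w + 1 + (d + 1))) := fun d => by
    have h2 : coeff n ((1 - X) * X ^ (d + 1) * rectSeries (d + 1) 2) =
        coeff n ((1 - X) * X ^ (d + 1) * rectSum (n + 1) (d + 1) 2) := by
      have := (X_pow_dvd_rectSeries_sub (n + 1) (d + 1) 2).mul_left ((1 - X) * X ^ (d + 1))
      have := X_pow_dvd_iff.mp this n (Nat.lt_succ_self n)
      rwa [mul_sub, map_sub, sub_eq_zero] at this
    rw [h2, ← map_add]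
    congr 1
    -- The term w = 0 corresponds to no partition with ones, so it is split off; summed over d it
    -- telescopes to (1-q)(P - 1) up to q^n.
    rw [rectSum, Finset.sum_range_succ', mul_add, add_comm, Finset.mul_sum]
    congr 1
    · have := boundedGF_succ d
      simp only [zero_mul, mul_zero, add_zero, pow_zero, one_mul, zero_add, boundedGF_zero]
      linear_combination (X - 1) * this
    · refine Finset.sum_congr rfl fun w _ => ?_
      rw [partGF_ones _ _ (Nat.le_add_left 1 w)]
      have e : w + 1 + (w + 1 + (d + 1)) * (w + 1 + 1) =
        (d + 1) + ((w + 1) * (w + 1 + (d + 1)) + 2 * (w + 1)) := by ring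
      rw [e, pow_add X (d + 1)]
      ring
  have h3 : coeff n (∑ d ∈ Finset.range n, (1 - X) * X ^ (d + 1) * rectSeries (d + 1) 2) =
      coeff n (rectSeries n 1 - rectSeries 0 1) := by
    simp only [rectSeries_two_right, Finset.sum_range_sub (fun d => rectSeries d 1)]
  rw [map_sum] at h3
  simp only [h1] at h3
  rw [Finset.sum_add_distrib, ← map_sum, ← map_sum, ← Finset.mul_sum,
    Finset.sum_range_sub, boundedGF_zero] at h3
  rw [Finset.sum_comm]
  have h4 : coeff n (rectSeries n 1) = coeff n allGF := by
    have := X_pow_dvd_iff.mp (X_pow_dvd_rectSeries_sub_allGF n 1) n (Nat.lt_succ_self n)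
    rwa [map_sub, sub_eq_zero] at this
  have h5 : coeff n ((1 - X) * boundedGF n) = coeff n ((1 - X) * allGF) := by
    have : (X : ℤ⟦X⟧) ^ (n + 1) ∣ boundedGF n - allGF := X_pow_dvd_iff.mpr fun m hm => by
      rw [map_sub, coeff_allGF_eq_coeff_boundedGF (Nat.lt_succ_iff.mp hm), sub_self]
    have := X_pow_dvd_iff.mp (this.mul_left (1 - X)) n (Nat.lt_succ_self n)
    rwa [mul_sub, map_sub, sub_eq_zero] at this
  have h6 : X * allGF - rectSeries 0 1 + (1 - X) =
    allGF - rectSeries 0 1 - (1 - X) * allGF + (1 - X) := by ring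
  rw [h6]
  rw [mul_sub, map_sub, map_sub, h4, h5, mul_one] at h3
  rw [map_add, map_sub, map_sub]
  linarith

theorem crank_pos_iff {n : ℕ} (hn : n ≠ 0) (P : Nat.Partition n) :
    0 < crank P ↔ P.parts.count 1 = 0 ∨ (0 < P.parts.count 1 ∧
      P.parts.count 1 < (P.parts.filter (P.parts.count 1 < ·)).card) := by
  rw [crank]
  split_ifs with h
  · simp only [h, true_or, iff_true]
    obtain ⟨x, hx⟩ := Multiset.exists_mem_of_ne_zero (s := P.parts) fun h0 => hn (by
      rw [← P.parts_sum, h0, Multiset.sum_zero])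
    have := Multiset.le_sup hx
    have := P.parts_pos hx
    omega
  · omega

theorem card_parts_le {n : ℕ} (P : Nat.Partition n) : P.parts.card ≤ n := by
  have := Multiset.card_nsmul_le_sum (s := P.parts) (a := 1) fun x hx => P.parts_pos hx
  simpa [P.parts_sum] using this

theorem card_crank_pos {n : ℕ} (hn : n ≠ 0) :
    ((Finset.univ.filter (fun P : Nat.Partition n => 0 < crank P)).card : ℤ) =
      partCount (fun s => s.count 1 = 0) n +
      ∑ w ∈ Finset.range n, ∑ d ∈ Finset.range n,
        partCount (fun s => s.count 1 = w + 1 ∧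
          (s.filter (w + 1 < ·)).card = w + 1 + (d + 1)) n := by
  classical
  simp only [partCount, Finset.card_filter, Nat.cast_sum]
  simp only [Finset.sum_comm (s := Finset.range n) (t := Finset.univ)]
  rw [← Finset.sum_add_distrib]
  refine Finset.sum_congr rfl fun P _ => ?_
  simp only [crank_pos_iff hn]
  have hc := card_parts_le P
  have hle : P.parts.count 1 ≤ P.parts.card := Multiset.count_le_card _ _
  rcases Nat.eq_zero_or_pos (P.parts.count 1) with h0 | h0
  · simp [h0]
  · obtain ⟨c, hcc⟩ : ∃ c, P.parts.count 1 = c + 1 := ⟨_, (Nat.succ_pred_eq_of_pos h0).symm⟩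
    -- At most one pair (w, d) matches a given partition; both indices are below n because there are
    -- at most n parts.
    rw [hcc, Finset.sum_eq_single_of_mem c (Finset.mem_range.mpr (by omega))]
    · have hf : (P.parts.filter (c + 1 < ·)).card ≤ P.parts.card :=
        Multiset.card_le_card (Multiset.filter_le _ _)
      by_cases hlt : c + 1 < (P.parts.filter (c + 1 < ·)).card
      · obtain ⟨d, hd⟩ := Nat.exists_eq_add_of_lt hlt
        rw [Finset.sum_eq_single_of_mem d (Finset.mem_range.mpr (by omega))]
        · rw [hd]; simp [add_assoc]
        · intro e _ he
          rw [if_neg (by omega)]; rfl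
      · rw [Finset.sum_eq_zero]
        · simp [hlt]
        · intro e _
          rw [if_neg (by omega)]; rfl
    · intro w _ hw
      exact Finset.sum_eq_zero fun d _ => by rw [if_neg (by omega)]; rfl

/-- The literal count by ones yields P - R(0,1) + (1 - q). The surplus 1 - q matters only at n = 0,
where the empty partition has crank 0, and at n = 1, where the convention sets D(1) = 1. -/
theorem positiveCrankCount_eq_coeff (n : ℕ) :
    positiveCrankCount n = coeff n (allGF - rectSeries 0 1) := by
  have hX : allGF - rectSeries 0 1 = X * rectSeries 1 1 := by
    rw [rectSeries_one_right 0]; ring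
  rcases eq_or_ne n 0 with rfl | h0
  · rw [hX]
    simp [positiveCrankCount, crank]
  rcases eq_or_ne n 1 with rfl | h1
  · rw [hX, show 1 = 0 + 1 from rfl, coeff_succ_X_mul, rectSeries, coeff_mk, rectSum,
      Finset.sum_range_one, boundedGF_zero]
    simp only [positiveCrankCount, zero_mul, mul_zero, add_zero, pow_zero, one_mul, zero_add,
      ↓reduceIte, ← coeff_allGF_eq_coeff_boundedGF (Nat.zero_le 1), coeff_allGF]
    simp [partitionFn]
  · rw [positiveCrankCount, if_neg h1, card_crank_pos h0]
    have h2 := sum_partGF_ones n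
    have h3 := congrArg (coeff n) partGF_one_notMem
    simp only [map_sum, partGF, coeff_mk] at h2 h3
    rw [h2, h3, ← map_add]
    have : (1 - X) * allGF + (X * allGF - rectSeries 0 1 + (1 - X)) =
      allGF - rectSeries 0 1 + (1 - X) := by ring
    rw [this, map_add, map_sub (coeff n) 1 X, coeff_one, coeff_X, if_neg h0, if_neg h1]
    simp

/-! ### The signed error as a single coefficient -/

theorem truncatedSum_sub_positiveCrankCount (n : ℕ) {k : ℕ} (hk : 1 ≤ k) :
    (-1 : ℤ) ^ (k - 1) * (truncatedSum n k - positiveCrankCount n) =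
      coeff n (X ^ ((k + 1) * (k + 2) / 2) * rectSeries (k + 1) 1) := by
  obtain ⟨k, rfl⟩ := Nat.exists_eq_add_of_le' hk
  rw [positiveCrankCount_eq_coeff, coeff_allGF_sub_rectSeries n (k + 1), Nat.add_sub_cancel]
  have : ((-1 : ℤ) ^ k) * (-1) ^ k = 1 := by rw [← mul_pow]; simp
  rw [pow_succ]
  linear_combination coeff n (X ^ ((k + 1 + 1) * (k + 1 + 2) / 2) * rectSeries (k + 1 + 1) 1) * this

theorem mainTheorem8 :
    (∀ n k : ℕ, 1 ≤ k →
      0 ≤ (-1 : ℤ) ^ (k - 1) * (truncatedSum n k - positiveCrankCount n) ∧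
      ((k + 1) * (k + 2) / 2 ≤ n →
        0 < (-1 : ℤ) ^ (k - 1) * (truncatedSum n k - positiveCrankCount n))) ∧
    (∀ n : ℕ,
      positiveCrankCount n ≤ partitionFn ((n : ℤ) - 1) ∧
      partitionFn ((n : ℤ) - 1) - partitionFn ((n : ℤ) - 3) ≤ positiveCrankCount n ∧
      positiveCrankCount n ≤
        partitionFn ((n : ℤ) - 1) - partitionFn ((n : ℤ) - 3) + partitionFn ((n : ℤ) - 6) ∧
      partitionFn ((n : ℤ) - 1) - partitionFn ((n : ℤ) - 3) + partitionFn ((n : ℤ) - 6)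
        - partitionFn ((n : ℤ) - 10) ≤ positiveCrankCount n) := by
  have key : ∀ n k : ℕ, 1 ≤ k →
      0 ≤ (-1 : ℤ) ^ (k - 1) * (truncatedSum n k - positiveCrankCount n) ∧
      ((k + 1) * (k + 2) / 2 ≤ n →
        0 < (-1 : ℤ) ^ (k - 1) * (truncatedSum n k - positiveCrankCount n)) := by
    intro n k hk
    rw [truncatedSum_sub_positiveCrankCount n hk, coeff_X_pow_mul']
    refine ⟨?_, fun h => ?_⟩
    · split_ifs
      · exact coeff_rectSeries_nonneg _ _ _
      · rfl
    · rw [if_pos h]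
      exact coeff_rectSeries_pos (Nat.le_add_left 1 k) _ _
  refine ⟨key, fun n => ?_⟩
  have h1 := (key n 1 (by norm_num)).1
  have h2 := (key n 2 (by norm_num)).1
  have h3 := (key n 3 (by norm_num)).1
  have h4 := (key n 4 (by norm_num)).1
  simp only [truncatedSum, Finset.sum_Icc_succ_top, Nat.le_add_left, Finset.Icc_self,
    Finset.sum_singleton, show (4 : ℕ) = 3 + 1 from rfl, show (3 : ℕ) = 2 + 1 from rfl,
    show (2 : ℕ) = 1 + 1 from rfl] at h1 h2 h3 h4
  norm_num at h1 h2 h3 h4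
  refine ⟨?_, ?_, ?_, ?_⟩ <;> linarith
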